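/- Let the Euler numbers $E_n$ ($n\ge 0$) be defined by $\tan x+\sec x=\sum_{n\ge 0}E_n\frac{x^n}{n!}$. Then the ordinary generating function of the Euler numbers has the expansion $$\sum_{n\ge 0}E_nx^n=b_0+\cfrac{a_1}{b_1+\cfrac{a_2}{b_2+\cfrac{a_3}{b_3+\cdots}}}=\cfrac{1}{1-x-\cfrac{x^3}{1-2x-4x^2-\cfrac{9x^3}{1-5x-\cfrac{4x^2}{1-7x-\cdots}}}},$$ where $$a_1=1,\qquad a_{3k}=-(4k-1)^2(2k-1)x^3\ (k\ge 1),\qquad a_{3k+1}=-4k^2x^2\ (k\ge 1),\qquad a_{3k+2}=-(4k+1)^2(2k+1)x^3\ (k\ge 0),$$ $$b_0=0,\qquad b_{3k}=1-(6k-1)x\ (k\ge 1),\qquad b_{3k+1}=1-(6k+1)x\ (k\ge 0),\qquad b_{3k+2}=1-2(2k+1)x-4(2k+1)^2x^2\ (k\ge 0).$$ The equality means that the denominators of the convergents (given by the usual three-term recurrence) are nonzero from some index on and that the convergents tend to $\sum_{n\ge0} E_nx^n$ in the $x$-adic topology of $\mathbb{Q}((x))$. Moreover, this continued fraction is a Hankel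 continued fraction (super $2$-fraction), i.e. it has the form $$\cfrac{v_0x^{k_0}}{1+u_1(x)x-\cfrac{v_1x^{k_0+k_1+2}}{1+u_2(x)x-\cfrac{v_2x^{k_1+k_2+2}}{1+u_3(x)x-\cdots}}}$$ with nonzero constants $v_j\in\mathbb{Q}$, nonnegative integers $k_j$, and polynomials $u_j\in\mathbb{Q}[x]$ of degree at most $k_{j-1}$. -/

import Mathlib

open Filter Topology
open scoped LaurentSeries PowerSeries

noncomputable section

/-- The Euler numbers `E n`, defined by the exponential generating function
`tan x + sec x = ∑ E n * x ^ n / n!`, where `tan x = sin x * (cos x)⁻¹` and `sec x = (cos x)⁻¹`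
as formal power series. -/
def eulerNumber (n : ℕ) : ℚ :=
  (n.factorial : ℚ) * PowerSeries.coeff n
    (PowerSeries.sin ℚ * (PowerSeries.cos ℚ)⁻¹ + (PowerSeries.cos ℚ)⁻¹)

/-- The (non-terminating) generalized continued fraction
`b 0 + a 1 / (b 1 + a 2 / (b 2 + a 3 / (b 3 + ⋯)))`. The value `a 0` is not used. -/
def genContFract {L : Type*} (a b : ℕ → L) : GenContFract L :=
  ⟨b 0, Stream'.Seq.ofStream fun n => ⟨a (n + 1), b (n + 1)⟩⟩

/-- The generalized continued fraction with coefficients `a 1, a 2, …` and `b 0, b 1, …` in `K(x)`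
has the formal power series `F` as its value: all but finitely many of the denominators of
its convergents are nonzero, and the convergents (rational functions, viewed as Laurent series)
tend to `F` in the `x`-adic topology of `K((x))`. -/
def ContFractHasValue {K : Type*} [Field K] (a b : ℕ → RatFunc K) (F : K⟦X⟧) : Prop :=
  (∀ᶠ n in atTop, (genContFract a b).dens n ≠ 0) ∧
    Tendsto (fun n => (((genContFract a b).convs n : RatFunc K) : K⸨X⸩)) atTop (𝓝 (F : K⸨X⸩))

/-- The (non-terminating) continued fraction with coefficients `a`, `b` is a super `δ`-fraction:
it has the form
`v₀ x^k₀ / (1 + u₁(x) x - v₁ x^(k₀+k₁+δ) / (1 + u₂(x) x - v₂ x^(k₁+k₂+δ) / (1 + u₃(x) x - ⋯)))`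
with constants `vⱼ ≠ 0`, integers `kⱼ ≥ 0` and polynomials `uⱼ` of degree at most
`kⱼ₋₁ + δ - 2`, where the polynomial `0` is given the degree `-1`. -/
def IsSuperFraction {K : Type*} [Field K] (δ : ℕ) (a b : ℕ → RatFunc K) : Prop :=
  1 ≤ δ ∧ ∃ (v : ℕ → K) (k : ℕ → ℕ) (u : ℕ → Polynomial K),
    (∀ j, v j ≠ 0) ∧
    (∀ j, u (j + 1) = 0 ∨ (u (j + 1)).natDegree + 2 ≤ k j + δ) ∧
    b 0 = 0 ∧
    a 1 = RatFunc.C (v 0) * RatFunc.X ^ k 0 ∧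
    (∀ j, a (j + 2) = -(RatFunc.C (v (j + 1)) * RatFunc.X ^ (k j + k (j + 1) + δ))) ∧
    (∀ j, b (j + 1) = 1 + algebraMap (Polynomial K) (RatFunc K) (u (j + 1)) * RatFunc.X)

/-- A Hankel continued fraction is a super `2`-fraction. -/
def IsHankelContFract {K : Type*} [Field K] (a b : ℕ → RatFunc K) : Prop :=
  IsSuperFraction 2 a b

end

/-!
Let `h = tan x + sec x - 1`, and let `V m` be the series obtained from `h ^ m` by the formal Laplace
transform `∑ cₙ xⁿ ↦ ∑ n! cₙ xⁿ` (`laplacePow`). Then `V 0 = 1` and `V 0 + V 1 = ∑ E n * x ^ n`. The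
transform turns differentiation into division by `x`, so the Riccati equation `h' = 1 + h + h² / 2`
becomes the three-term recurrence `2 V (m + 1) = (m + 1) x (2 V m + 2 V (m + 1) + V (m + 2))`
(`laplacePow_rec`).

A continued fraction with value `F` is governed by the remainders `B n * F - A n` of its convergents
`A n / B n`: they satisfy the same recurrence as `A` and `B`, and when all `B n` have constant term
`1`, the convergents tend to `F` once the `n`-th remainder is divisible by `x ^ n`
(`contFractHasValue_of_remainder`). For the Euler numbers the remainders are explicit: up to a
constant and a power of `x` they are `V (4 k) + V (4 k + 1)`, `V (4 k + 2)` and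
`2 V (4 k + 3) + V (4 k + 4)` for the indices `3 k`, `3 k + 1` and `3 k + 2`. That these satisfy the
recurrence of the continued fraction follows from the one for `V` (`remainder_rec`), and the powers
of `x` give the divisibility. Three steps of the fraction thus advance the index of `V` by four,
whence the period three and the one quadratic partial denominator in each period.

The shape of a Hankel continued fraction is read off from the coefficients, with `k_j = 1` if
`j ≡ 1` modulo `3` and `k_j = 0` otherwise.
-/

/-! ### Convergence of continued fractions with polynomial coefficients -/

/-- Power series that agree with `F` modulo higher and higher powers of `X` tend to `F` in the
`X`-adic topology of the Laurent series. -/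
theorem tendsto_coe_of_X_pow_dvd {K : Type*} [Field K] {g : ℕ → K⟦X⟧} {F : K⟦X⟧}
    (h : ∀ n, PowerSeries.X ^ n ∣ g n - F) :
    Tendsto (fun n => (g n : K⸨X⸩)) atTop (𝓝 (F : K⸨X⸩)) := by
  refine fun s hs => ?_
  obtain ⟨γ, hγ⟩ := Valued.mem_nhds.mp hs
  set δ := MonoidWithZeroHom.ValueGroup₀.embedding γ.1
  have hδ : δ ≠ 0 := by simp [δ]
  rw [Filter.mem_map]
  filter_upwards [eventually_gt_atTop (-(WithZero.log δ)).toNat] with n hn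
  apply hγ
  rw [Set.mem_ofPred_eq, Valuation.restrict_lt_iff_lt_embedding]
  have h1 : WithZero.exp (-(n : ℤ)) < δ := by
    rw [← WithZero.lt_log_iff_exp_lt hδ]
    omega
  refine lt_of_le_of_lt ?_ h1
  rw [← PowerSeries.coe_sub, LaurentSeries.intValuation_le_iff_coeff_lt_eq_zero]
  exact PowerSeries.X_pow_dvd_iff.mp (h n)

/-- A continued fraction with polynomial coefficients `α`, `β` whose partial denominators have
constant term `1` and whose partial numerators, from the second on, vanish at `0` has the value
`F` as soon as the solution `R` of its three-term recurrence that starts with the remainders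
`F - β 0` and `β 1 * (F - β 0) - α 1` vanishes to higher and higher order. This `R n` is
`B n * F - A n`, where `A n / B n` is the `n`-th convergent. -/
theorem contFractHasValue_of_remainder {K : Type*} [Field K] (α β : ℕ → Polynomial K)
    (F : K⟦X⟧) (R : ℕ → K⟦X⟧) (hα : ∀ n, (α (n + 2)).coeff 0 = 0)
    (hβ : ∀ n, (β (n + 1)).coeff 0 = 1) (R_zero : R 0 = F - β 0)
    (R_one : R 1 = β 1 * R 0 - α 1)
    (R_rec : ∀ n, R (n + 2) = β (n + 2) * R (n + 1) + α (n + 2) * R n)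
    (hR : ∀ n, PowerSeries.X ^ n ∣ R n) :
    ContFractHasValue (fun n => algebraMap (Polynomial K) (RatFunc K) (α n))
      (fun n => algebraMap (Polynomial K) (RatFunc K) (β n)) F := by
  set g := genContFract (fun n => algebraMap (Polynomial K) (RatFunc K) (α n))
    (fun n => algebraMap (Polynomial K) (RatFunc K) (β n)) with hg
  have hs : ∀ n, g.s.get? n = some ⟨algebraMap (Polynomial K) (RatFunc K) (α (n + 1)),
    algebraMap (Polynomial K) (RatFunc K) (β (n + 1))⟩ := fun n => rfl
  have key : ∀ n, ∃ A B : Polynomial K,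
      g.nums n = algebraMap _ _ A ∧ g.dens n = algebraMap _ _ B ∧ B.coeff 0 = 1 ∧
      (B : K⟦X⟧) * F - A = R n := by
    intro n
    induction n using Nat.twoStepInduction with
    | zero =>
      exact ⟨β 0, 1, GenContFract.zeroth_num_eq_h, by simp, by simp, by simp [R_zero]⟩
    | one =>
      refine ⟨β 1 * β 0 + α 1, β 1, ?_, ?_, hβ 0, ?_⟩
      · rw [GenContFract.first_num_eq (hs 0)]
        simp [hg, genContFract]
      · rw [GenContFract.first_den_eq (hs 0)]
      · rw [R_one, R_zero]
        push_cast
        ring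
    | more n ih ih' =>
      obtain ⟨A, B, hA, hB, h0, h⟩ := ih
      obtain ⟨A', B', hA', hB', h0', h'⟩ := ih'
      refine ⟨β (n + 2) * A' + α (n + 2) * A, β (n + 2) * B' + α (n + 2) * B, ?_, ?_, ?_, ?_⟩
      · rw [GenContFract.nums_recurrence (hs (n + 1)) hA hA']
        simp
      · rw [GenContFract.dens_recurrence (hs (n + 1)) hB hB']
        simp
      · simp [Polynomial.mul_coeff_zero, hβ (n + 1), hα, h0']
      · rw [R_rec, ← h, ← h']
        push_cast
        ring
  choose A B hA hB h0 h using key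
  have hB0 : ∀ n, B n ≠ 0 := by
    intro n hn
    simpa [hn] using h0 n
  have hB1 : ∀ n, PowerSeries.constantCoeff (B n : K⟦X⟧) ≠ 0 := by
    intro n
    simp [h0 n]
  refine ⟨Eventually.of_forall fun n => ?_, ?_⟩
  · rw [← hg, hB]
    exact (map_ne_zero_iff _ (RatFunc.algebraMap_injective K)).mpr (hB0 n)
  · have hcoe : ∀ P : Polynomial K,
        ((algebraMap (Polynomial K) (RatFunc K) P : RatFunc K) : K⸨X⸩) = ((P : K⟦X⟧) : K⸨X⸩) :=
      fun P => (RatFunc.coe_coe P).symm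
    have hconv : ∀ n, ((g.convs n : RatFunc K) : K⸨X⸩) =
        (((A n : K⟦X⟧) * (B n : K⟦X⟧)⁻¹ : K⟦X⟧) : K⸨X⸩) := by
      intro n
      have hne : ((B n : K⟦X⟧) : K⸨X⸩) ≠ 0 := by
        rw [← PowerSeries.coe_zero]
        exact fun h' => hB1 n (by simp [HahnSeries.ofPowerSeries_injective h'])
      rw [GenContFract.conv_eq_num_div_den, hA, hB, map_div₀, hcoe, hcoe, div_eq_iff hne,
        ← PowerSeries.coe_mul, mul_assoc, PowerSeries.inv_mul_cancel _ (hB1 n), mul_one]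
    refine (tendsto_coe_of_X_pow_dvd fun n => ?_).congr fun n => (hconv n).symm
    have : (A n : K⟦X⟧) * (B n : K⟦X⟧)⁻¹ - F = -(B n : K⟦X⟧)⁻¹ * R n := by
      linear_combination (-(B n : K⟦X⟧)⁻¹) * h n + F * PowerSeries.inv_mul_cancel _ (hB1 n)
    rw [this]
    exact (hR n).mul_left _

/-! ### The powers of `tan + sec - 1` and their Laplace transforms -/

theorem derivative_sin : d⁄dX ℚ (PowerSeries.sin ℚ) = PowerSeries.cos ℚ := by
  ext n
  have : (n.factorial : ℚ) ≠ 0 := by positivity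
  rw [PowerSeries.coeff_derivative, PowerSeries.sin, PowerSeries.cos, PowerSeries.coeff_mk,
    PowerSeries.coeff_mk]
  obtain ⟨k, rfl | rfl⟩ := Nat.even_or_odd' n
  · have : (2 * k + 1) / 2 = k := by omega
    simp [Nat.factorial_succ, this]
    field_simp
  · simp [Nat.even_add_one]

theorem derivative_cos : d⁄dX ℚ (PowerSeries.cos ℚ) = -PowerSeries.sin ℚ := by
  ext n
  have : (n.factorial : ℚ) ≠ 0 := by positivity
  rw [PowerSeries.coeff_derivative, map_neg, PowerSeries.sin, PowerSeries.cos,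
    PowerSeries.coeff_mk, PowerSeries.coeff_mk]
  obtain ⟨k, rfl | rfl⟩ := Nat.even_or_odd' n
  · simp
  · have : (2 * k + 1) / 2 = k := by omega
    have : (2 * k + 1 + 1) / 2 = k + 1 := by omega
    simp [Nat.even_add_one, Nat.factorial_succ, *]
    field_simp
    ring

theorem constantCoeff_sin : PowerSeries.constantCoeff (PowerSeries.sin ℚ) = 0 := by
  simp [← PowerSeries.coeff_zero_eq_constantCoeff_apply, PowerSeries.sin]

theorem constantCoeff_cos : PowerSeries.constantCoeff (PowerSeries.cos ℚ) = 1 := by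
  simp [← PowerSeries.coeff_zero_eq_constantCoeff_apply, PowerSeries.cos]

theorem sin_sq_add_cos_sq : PowerSeries.sin ℚ ^ 2 + PowerSeries.cos ℚ ^ 2 = 1 := by
  apply PowerSeries.derivative.ext
  · simp [derivative_sin, derivative_cos]
    ring
  · simp [constantCoeff_sin, constantCoeff_cos]

/-- The power series `tan x + sec x - 1`. -/
noncomputable def tanAddSecSubOne : ℚ⟦X⟧ :=
  PowerSeries.sin ℚ * (PowerSeries.cos ℚ)⁻¹ + (PowerSeries.cos ℚ)⁻¹ - 1

theorem constantCoeff_tanAddSecSubOne : PowerSeries.constantCoeff tanAddSecSubOne = 0 := by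
  simp [tanAddSecSubOne, constantCoeff_sin, constantCoeff_cos]

/-- The Riccati equation `h' = 1 + h + h² / 2` for `h = tan x + sec x - 1`. -/
theorem two_mul_derivative_tanAddSecSubOne :
    2 * d⁄dX ℚ tanAddSecSubOne = 2 + 2 * tanAddSecSubOne + tanAddSecSubOne ^ 2 := by
  have h : PowerSeries.cos ℚ * (PowerSeries.cos ℚ)⁻¹ = 1 :=
    PowerSeries.mul_inv_cancel _ (by simp [constantCoeff_cos])
  have h1 := sin_sq_add_cos_sq
  simp only [tanAddSecSubOne, map_sub, map_add, Derivation.leibniz, derivative_sin,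
    PowerSeries.derivative_inv', derivative_cos, Derivation.map_one_eq_zero, smul_eq_mul]
  generalize PowerSeries.sin ℚ = s at *
  generalize PowerSeries.cos ℚ = c at *
  generalize c⁻¹ = i at *
  linear_combination (i ^ 2) * h1 + (1 - c * i) * h

/-- The formal Laplace transform `∑ cₙ xⁿ ↦ ∑ n! cₙ xⁿ`, which turns exponential generating
functions into ordinary ones. -/
noncomputable def formalLaplace : ℚ⟦X⟧ →ₗ[ℚ] ℚ⟦X⟧ where
  toFun f := PowerSeries.mk fun n => (n.factorial : ℚ) * PowerSeries.coeff n f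
  map_add' f g := by
    ext n
    simp [mul_add]
  map_smul' c f := by
    ext n
    simp [mul_left_comm]

theorem X_mul_formalLaplace_derivative {f : ℚ⟦X⟧} (hf : PowerSeries.constantCoeff f = 0) :
    PowerSeries.X * formalLaplace (d⁄dX ℚ f) = formalLaplace f := by
  ext n
  cases n with
  | zero => simp [formalLaplace, hf]
  | succ n =>
    rw [PowerSeries.coeff_succ_X_mul]
    simp only [formalLaplace, LinearMap.coe_mk, AddHom.coe_mk, PowerSeries.coeff_mk,
      PowerSeries.coeff_derivative, Nat.factorial_succ]
    push_cast
    ring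

/-- The Laplace transform of `(tan x + sec x - 1) ^ m`. -/
noncomputable def laplacePow (m : ℕ) : ℚ⟦X⟧ :=
  formalLaplace (tanAddSecSubOne ^ m)

theorem formalLaplace_one : formalLaplace 1 = 1 := by
  ext n
  rcases n with _ | n <;> simp [formalLaplace, PowerSeries.coeff_one]

theorem laplacePow_zero : laplacePow 0 = 1 := by
  rw [laplacePow, pow_zero, formalLaplace_one]

/-- Since `laplacePow 0 = 1`, the generating function of the Euler numbers is the sum of the first
two of these series. -/
theorem mk_eulerNumber : PowerSeries.mk eulerNumber = laplacePow 0 + laplacePow 1 := by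
  rw [laplacePow, laplacePow, ← map_add]
  ext n
  simp [formalLaplace, tanAddSecSubOne, eulerNumber]

/-- The Riccati equation gives `2 (h ^ (m + 1))' = (m + 1) (2 h ^ m + 2 h ^ (m + 1) + h ^ (m + 2))`
for `h = tan x + sec x - 1`; its Laplace transform is a three-term recurrence. -/
theorem laplacePow_rec (m : ℕ) :
    2 * laplacePow (m + 1) = (PowerSeries.X : ℚ⟦X⟧) * (m + 1) *
      (2 * laplacePow m + 2 * laplacePow (m + 1) + laplacePow (m + 2)) := by
  have h : (2 : ℚ) • d⁄dX ℚ (tanAddSecSubOne ^ (m + 1)) =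
      (m + 1 : ℚ) • ((2 : ℚ) • tanAddSecSubOne ^ m + (2 : ℚ) • tanAddSecSubOne ^ (m + 1) +
        tanAddSecSubOne ^ (m + 2)) := by
    rw [PowerSeries.derivative_pow]
    simp only [PowerSeries.smul_eq_C_mul, map_add, map_natCast, map_one, map_ofNat]
    rw [add_tsub_cancel_right]
    push_cast
    linear_combination (m + 1) * tanAddSecSubOne ^ m * two_mul_derivative_tanAddSecSubOne
  have h' := congrArg (fun f => PowerSeries.X * formalLaplace f) h
  simp only [map_smul, map_add, mul_smul_comm] at h'
  rw [X_mul_formalLaplace_derivative (by simp [constantCoeff_tanAddSecSubOne])] at h'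
  simp only [PowerSeries.smul_eq_C_mul, map_add, map_natCast, map_one, map_ofNat] at h'
  simp only [laplacePow]
  linear_combination h'

/-! ### The coefficients of the continued fraction -/

/-- The sequence `f 0, g 0, h 0, f 1, g 1, h 1, …`. -/
def interlace {A : Type*} (f g h : ℕ → A) (n : ℕ) : A :=
  if n % 3 = 0 then f (n / 3) else if n % 3 = 1 then g (n / 3) else h (n / 3)

section interlace

variable {A : Type*} (f g h : ℕ → A) (k : ℕ)

@[simp] theorem interlace_three_mul : interlace f g h (3 * k) = f k := by
  simp [interlace]

@[simp] theorem interlace_three_mul_add_one : interlace f g h (3 * k + 1) = g k := by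
  have : (3 * k + 1) / 3 = k := by omega
  have : (3 * k + 1) % 3 = 1 := by omega
  simp [interlace, *]

@[simp] theorem interlace_three_mul_add_two : interlace f g h (3 * k + 2) = h k := by
  have : (3 * k + 2) / 3 = k := by omega
  have : (3 * k + 2) % 3 = 2 := by omega
  simp [interlace, *]

end interlace

theorem forall_of_mod_three {P : ℕ → Prop} (h0 : ∀ k, P (3 * k)) (h1 : ∀ k, P (3 * k + 1))
    (h2 : ∀ k, P (3 * k + 2)) (n : ℕ) : P n := by
  have h : n = 3 * (n / 3) ∨ n = 3 * (n / 3) + 1 ∨ n = 3 * (n / 3) + 2 := by omega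
  rcases h with h | h | h <;> rw [h] <;> apply_assumption

open Polynomial in
/-- The partial numerators of the continued fraction, as polynomials. The index `0`, where the
value is not used, follows the general formula. -/
noncomputable def numPoly : ℕ → ℚ[X] :=
  interlace (fun k => -(C ((4 * k - 1) ^ 2 * (2 * k - 1) : ℚ) * X ^ 3))
    (fun k => if k = 0 then 1 else -(C (4 * k ^ 2 : ℚ) * X ^ 2))
    (fun k => -(C ((4 * k + 1) ^ 2 * (2 * k + 1) : ℚ) * X ^ 3))

open Polynomial in
/-- The partial denominators of the continued fraction, as polynomials. -/
noncomputable def denPoly : ℕ → ℚ[X] :=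
  interlace (fun k => if k = 0 then 0 else 1 - C (6 * k - 1 : ℚ) * X)
    (fun k => 1 - C (6 * k + 1 : ℚ) * X)
    (fun k => 1 - C (2 * (2 * k + 1) : ℚ) * X - C (4 * (2 * k + 1) ^ 2 : ℚ) * X ^ 2)

/-! ### The remainders of the convergents -/

/-- The constant factor of the remainder with index `3 * k`. -/
def remainderScale : ℕ → ℚ
  | 0 => 1
  | k + 1 => (k + 1) * (4 * k + 3) * (2 * k + 1) * (4 * k + 1) / 2 * remainderScale k

open PowerSeries in
/-- The remainders `B n * F - A n` of the convergents `A n / B n`, where `F = ∑ E n * x ^ n`: up to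
constants and powers of `x`, with `V m` the Laplace transform of `(tan x + sec x - 1) ^ m`, they are
`V (4 k) + V (4 k + 1)`, `V (4 k + 2)` and `2 V (4 k + 3) + V (4 k + 4)`. -/
noncomputable def remainder : ℕ → ℚ⟦X⟧ :=
  interlace
    (fun k => C (remainderScale k) * X ^ (4 * k) * (laplacePow (4 * k) + laplacePow (4 * k + 1)))
    (fun k => C ((4 * k + 1) / 2 * remainderScale k) * X ^ (4 * k + 1) * laplacePow (4 * k + 2))
    (fun k => C ((4 * k + 3) * (2 * k + 1) * (4 * k + 1) / 4 * remainderScale k) *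
      X ^ (4 * k + 3) * (2 * laplacePow (4 * k + 3) + laplacePow (4 * k + 4)))

theorem X_pow_dvd_remainder : ∀ n, PowerSeries.X ^ n ∣ remainder n := by
  apply forall_of_mod_three <;> intro k <;>
    simp only [remainder, interlace_three_mul, interlace_three_mul_add_one,
      interlace_three_mul_add_two] <;>
    refine Dvd.dvd.mul_right (Dvd.dvd.mul_left (pow_dvd_pow _ ?_) _) _ <;> omega

/-- The remainder of index `0` is `∑ E n * x ^ n` itself, see `mk_eulerNumber`. -/
theorem remainder_zero : remainder 0 = laplacePow 0 + laplacePow 1 := by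
  simp [remainder, interlace, remainderScale]

theorem two_ne_zero_powerSeries : (2 : ℚ⟦X⟧) ≠ 0 := by
  rw [← map_ofNat PowerSeries.C 2]
  simp

theorem remainder_one :
    remainder 1 = (denPoly 1 : ℚ⟦X⟧) * remainder 0 - (numPoly 1 : ℚ⟦X⟧) := by
  have h := laplacePow_rec 0
  have hC : (2 : ℚ⟦X⟧) * PowerSeries.C (1 / 2) = 1 := by
    rw [← map_ofNat PowerSeries.C 2, ← map_mul]
    norm_num
  rw [remainder_zero]
  simp [remainder, interlace, remainderScale, denPoly, numPoly, -one_div] at h ⊢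
  rw [laplacePow_zero] at *
  apply mul_left_cancel₀ two_ne_zero_powerSeries
  linear_combination PowerSeries.X * laplacePow 2 * hC - h

/-- The constant factors of the remainders with indices `3 * k` and `3 * k + 1`. -/
theorem C_midScale (k : ℕ) : 2 * PowerSeries.C ((4 * k + 1) / 2 * remainderScale k) =
    (4 * k + 1) * PowerSeries.C (remainderScale k) := by
  have h : 2 * ((4 * k + 1) / 2 * remainderScale k) = (4 * k + 1) * remainderScale k := by ring
  simpa only [map_mul, map_add, map_natCast, map_ofNat, map_one] using congrArg PowerSeries.C h

/-- The constant factors of the remainders with indices `3 * k + 1` and `3 * k + 2`. -/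
theorem C_topScale (k : ℕ) :
    2 * PowerSeries.C ((4 * k + 3) * (2 * k + 1) * (4 * k + 1) / 4 * remainderScale k) =
    (4 * k + 3) * (2 * k + 1) * PowerSeries.C ((4 * k + 1) / 2 * remainderScale k) := by
  have h : 2 * ((4 * k + 3) * (2 * k + 1) * (4 * k + 1) / 4 * remainderScale k) =
      (4 * k + 3) * (2 * k + 1) * ((4 * k + 1) / 2 * remainderScale k) := by ring
  simpa only [map_mul, map_add, map_natCast, map_ofNat, map_one] using congrArg PowerSeries.C h

/-- The constant factors of the remainders with indices `3 * k + 2` and `3 * k + 3`. -/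
theorem C_remainderScale_succ (k : ℕ) : PowerSeries.C (remainderScale (k + 1)) =
    2 * (k + 1) *
      PowerSeries.C ((4 * k + 3) * (2 * k + 1) * (4 * k + 1) / 4 * remainderScale k) := by
  have h : remainderScale (k + 1) =
      2 * (k + 1) * ((4 * k + 3) * (2 * k + 1) * (4 * k + 1) / 4 * remainderScale k) := by
    rw [remainderScale]
    ring
  simpa only [map_mul, map_add, map_natCast, map_ofNat, map_one] using congrArg PowerSeries.C h

/-- The three-term recurrence with coefficients `denPoly` and `numPoly`: in each residue class
modulo `3` it is a linear combination of two or three instances of `laplacePow_rec` and the ratios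
of the constant factors. -/
theorem remainder_rec : ∀ n, remainder (n + 2) = (denPoly (n + 2) : ℚ⟦X⟧) * remainder (n + 1) +
    (numPoly (n + 2) : ℚ⟦X⟧) * remainder n := by
  apply forall_of_mod_three <;> intro k
  · have h0 := C_midScale k
    have h1 := C_topScale k
    have r0 := laplacePow_rec (4 * k + 0)
    have r1 := laplacePow_rec (4 * k + 1)
    have r2 := laplacePow_rec (4 * k + 2)
    simp only [remainder, denPoly, numPoly, interlace_three_mul, interlace_three_mul_add_one,
      interlace_three_mul_add_two]
    generalize PowerSeries.C ((4 * k + 3) * (2 * k + 1) * (4 * k + 1) / 4 * remainderScale k) = e at *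
    generalize PowerSeries.C ((4 * k + 1) / 2 * remainderScale k) = d at *
    generalize PowerSeries.C (remainderScale k) = c at *
    simp only [Polynomial.coe_sub, Polynomial.coe_neg, Polynomial.coe_mul, Polynomial.coe_pow,
      Polynomial.coe_C, Polynomial.coe_X, Polynomial.coe_one]
    simp only [map_mul, map_add, map_pow, map_natCast, map_ofNat, map_one]
    apply mul_left_cancel₀ two_ne_zero_powerSeries
    push_cast [mul_add, Nat.add_assoc, Nat.reduceAdd, mul_one] at *
    linear_combination
      PowerSeries.X ^ (4 * k + 3) * (2 * laplacePow (4 * k + 3) + laplacePow (4 * k + 4)) * h1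
      - 2 * (4 * k + 1) * (2 * k + 1) * PowerSeries.X ^ (4 * k + 3) *
        (laplacePow (4 * k) + laplacePow (4 * k + 1)) * h0
      - d * PowerSeries.X ^ (4 * k + 1) * r1
      - (2 * k + 1) * d * PowerSeries.X ^ (4 * k + 2) * (r2 + 2 * r0)
  · have h1 := C_topScale k
    have h2 := C_remainderScale_succ k
    have r2 := laplacePow_rec (4 * k + 2)
    have r3 := laplacePow_rec (4 * k + 3)
    rw [show 3 * k + 1 + 2 = 3 * (k + 1) by ring, show 3 * k + 1 + 1 = 3 * k + 2 by ring]
    simp only [remainder, denPoly, numPoly, interlace_three_mul, interlace_three_mul_add_one,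
      interlace_three_mul_add_two, Nat.add_one_ne_zero, if_false]
    generalize PowerSeries.C ((4 * k + 3) * (2 * k + 1) * (4 * k + 1) / 4 * remainderScale k) = e at *
    generalize PowerSeries.C ((4 * k + 1) / 2 * remainderScale k) = d at *
    generalize PowerSeries.C (remainderScale (k + 1)) = c at *
    simp only [Polynomial.coe_sub, Polynomial.coe_neg, Polynomial.coe_mul, Polynomial.coe_pow,
      Polynomial.coe_C, Polynomial.coe_X, Polynomial.coe_one]
    simp only [map_mul, map_sub, map_pow, map_natCast, map_ofNat, map_one]
    apply mul_left_cancel₀ two_ne_zero_powerSeries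
    push_cast [mul_add, Nat.add_assoc, Nat.reduceAdd, mul_one] at *
    linear_combination
      2 * PowerSeries.X ^ (4 * k + 4) * (laplacePow (4 * k + 4) + laplacePow (4 * k + 5)) * h2
      - 2 * (4 * k + 3) * PowerSeries.X ^ (4 * k + 4) * laplacePow (4 * k + 2) * h1
      - e * PowerSeries.X ^ (4 * k + 3) * (2 * r2 + r3)
  · have h0 := C_midScale (k + 1)
    have h2 := C_remainderScale_succ k
    have r3 := laplacePow_rec (4 * k + 3)
    have r4 := laplacePow_rec (4 * k + 4)
    rw [show 3 * k + 2 + 2 = 3 * (k + 1) + 1 by ring, show 3 * k + 2 + 1 = 3 * (k + 1) by ring]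
    simp only [remainder, denPoly, numPoly, interlace_three_mul, interlace_three_mul_add_one,
      interlace_three_mul_add_two, Nat.add_one_ne_zero, if_false]
    generalize PowerSeries.C ((4 * k + 3) * (2 * k + 1) * (4 * k + 1) / 4 * remainderScale k) = e at *
    generalize PowerSeries.C ((4 * (k + 1 : ℕ) + 1) / 2 * remainderScale (k + 1)) = d at *
    generalize PowerSeries.C (remainderScale (k + 1)) = c at *
    simp only [Polynomial.coe_sub, Polynomial.coe_neg, Polynomial.coe_mul, Polynomial.coe_pow,
      Polynomial.coe_C, Polynomial.coe_X, Polynomial.coe_one]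
    simp only [map_mul, map_add, map_pow, map_natCast, map_ofNat, map_one]
    apply mul_left_cancel₀ two_ne_zero_powerSeries
    push_cast [mul_add, Nat.add_assoc, Nat.reduceAdd, mul_one] at *
    linear_combination
      PowerSeries.X ^ (4 * k + 5) * laplacePow (4 * k + 6) * h0
      - 4 * (k + 1) * PowerSeries.X ^ (4 * k + 5) *
        (2 * laplacePow (4 * k + 3) + laplacePow (4 * k + 4)) * h2
      - c * PowerSeries.X ^ (4 * k + 4) * (r3 + r4)

/-! ### The continued fraction of the Euler numbers -/

theorem contFractHasValue_euler :
    ContFractHasValue (fun n => algebraMap (Polynomial ℚ) (RatFunc ℚ) (numPoly n))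
      (fun n => algebraMap (Polynomial ℚ) (RatFunc ℚ) (denPoly n))
      (PowerSeries.mk eulerNumber) := by
  refine contFractHasValue_of_remainder numPoly denPoly _ remainder ?_ ?_ ?_ remainder_one
    remainder_rec X_pow_dvd_remainder
  · apply forall_of_mod_three <;> intro k
    · simp [numPoly, Polynomial.mul_coeff_zero]
    · rw [show 3 * k + 1 + 2 = 3 * (k + 1) by ring]
      simp [numPoly, Polynomial.mul_coeff_zero]
    · rw [show 3 * k + 2 + 2 = 3 * (k + 1) + 1 by ring]
      simp [numPoly, Polynomial.mul_coeff_zero]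
  · apply forall_of_mod_three <;> intro k
    · simp [denPoly, Polynomial.mul_coeff_zero]
    · simp [denPoly, Polynomial.mul_coeff_zero]
    · rw [show 3 * k + 2 + 1 = 3 * (k + 1) by ring]
      simp [denPoly, Polynomial.mul_coeff_zero]
  · rw [mk_eulerNumber, remainder_zero]
    simp [denPoly, interlace]

open Polynomial in
theorem isHankelContFract_euler :
    IsHankelContFract (fun n => algebraMap ℚ[X] (RatFunc ℚ) (numPoly n))
      (fun n => algebraMap ℚ[X] (RatFunc ℚ) (denPoly n)) := by
  refine ⟨by norm_num,
    interlace (fun k => if k = 0 then 1 else 4 * (k : ℚ) ^ 2)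
      (fun k => (4 * (k : ℚ) + 1) ^ 2 * (2 * k + 1))
      (fun k => (4 * ((k + 1 : ℕ) : ℚ) - 1) ^ 2 * (2 * (k + 1 : ℕ) - 1)),
    interlace (fun _ => 0) (fun _ => 1) (fun _ => 0),
    interlace (fun k => -C (6 * k - 1 : ℚ)) (fun k => -C (6 * k + 1 : ℚ))
      (fun k => -C (2 * (2 * k + 1) : ℚ) - C (4 * (2 * k + 1) ^ 2 : ℚ) * X),
    ?_, ?_, ?_, ?_, ?_, ?_⟩
  · apply forall_of_mod_three <;> intro k
    · rw [interlace_three_mul]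
      by_cases hk : k = 0 <;> simp [hk]
    · simp only [interlace_three_mul_add_one]
      positivity
    · simp only [interlace_three_mul_add_two]
      have h1 : 4 * ((k + 1 : ℕ) : ℚ) - 1 = 4 * k + 3 := by push_cast; ring
      have h2 : 2 * ((k + 1 : ℕ) : ℚ) - 1 = 2 * k + 1 := by push_cast; ring
      rw [h1, h2]
      positivity
  · apply forall_of_mod_three <;> intro k <;> right
    · simp only [interlace_three_mul_add_one, interlace_three_mul, natDegree_neg, natDegree_C,
        le_refl]
    · simp only [interlace_three_mul_add_two, interlace_three_mul_add_one]
      have : (-C (2 * (2 * k + 1) : ℚ) - C (4 * (2 * k + 1) ^ 2 : ℚ) * X).natDegree ≤ 1 := by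
        compute_degree
      omega
    · rw [show 3 * k + 2 + 1 = 3 * (k + 1) by ring]
      simp only [interlace_three_mul_add_two, interlace_three_mul, natDegree_neg, natDegree_C,
        le_refl]
  · simp [denPoly, interlace]
  · simp [numPoly, interlace]
  · apply forall_of_mod_three <;> intro k
    · simp only [numPoly, interlace_three_mul, interlace_three_mul_add_one,
        interlace_three_mul_add_two, map_neg, map_mul, map_pow, RatFunc.algebraMap_C,
        RatFunc.algebraMap_X]
    · rw [show 3 * k + 1 + 2 = 3 * (k + 1) by ring, show 3 * k + 1 + 1 = 3 * k + 2 by ring]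
      simp only [numPoly, interlace_three_mul, interlace_three_mul_add_one,
        interlace_three_mul_add_two, map_neg, map_mul, map_pow, RatFunc.algebraMap_C,
        RatFunc.algebraMap_X]
    · rw [show 3 * k + 2 + 2 = 3 * (k + 1) + 1 by ring, show 3 * k + 2 + 1 = 3 * (k + 1) by ring]
      simp only [numPoly, interlace_three_mul, interlace_three_mul_add_one,
        interlace_three_mul_add_two, map_neg, map_mul, map_pow, RatFunc.algebraMap_C,
        RatFunc.algebraMap_X, Nat.add_one_ne_zero, if_false]
  · intro n
    rw [← RatFunc.algebraMap_X, ← map_mul, ← map_one (algebraMap ℚ[X] (RatFunc ℚ)), ← map_add]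
    refine congrArg (algebraMap ℚ[X] (RatFunc ℚ)) ?_
    revert n
    apply forall_of_mod_three <;> intro k
    · simp only [denPoly, interlace_three_mul_add_one]
      ring
    · simp only [denPoly, interlace_three_mul_add_two]
      ring
    · rw [show 3 * k + 2 + 1 = 3 * (k + 1) by ring]
      simp only [denPoly, interlace_three_mul, Nat.add_one_ne_zero, if_false]
      ring

theorem theorem1 :
    ∃ a b : ℕ → RatFunc ℚ,
      (a 1 = 1 ∧
        (∀ k : ℕ, 1 ≤ k →
          a (3 * k) = -(4 * (k : RatFunc ℚ) - 1) ^ 2 * (2 * (k : RatFunc ℚ) - 1) * RatFunc.X ^ 3) ∧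
        (∀ k : ℕ, 1 ≤ k →
          a (3 * k + 1) = -4 * (k : RatFunc ℚ) ^ 2 * RatFunc.X ^ 2) ∧
        (∀ k : ℕ,
          a (3 * k + 2) =
            -(4 * (k : RatFunc ℚ) + 1) ^ 2 * (2 * (k : RatFunc ℚ) + 1) * RatFunc.X ^ 3) ∧
        b 0 = 0 ∧
        (∀ k : ℕ, 1 ≤ k →
          b (3 * k) = -(6 * (k : RatFunc ℚ) - 1) * RatFunc.X + 1) ∧
        (∀ k : ℕ,
          b (3 * k + 1) = -(6 * (k : RatFunc ℚ) + 1) * RatFunc.X + 1) ∧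
        (∀ k : ℕ,
          b (3 * k + 2) = -4 * (2 * (k : RatFunc ℚ) + 1) ^ 2 * RatFunc.X ^ 2
            - 2 * (2 * (k : RatFunc ℚ) + 1) * RatFunc.X + 1)) ∧
      IsHankelContFract a b ∧
      ContFractHasValue a b (PowerSeries.mk eulerNumber) := by
  refine ⟨_, _, ⟨?_, ?_, ?_, ?_, ?_, ?_, ?_, ?_⟩, isHankelContFract_euler, contFractHasValue_euler⟩
  · simp [numPoly, interlace]
  · intro k _
    simp only [numPoly, interlace_three_mul, map_neg, map_mul, map_sub, map_pow, map_natCast,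
      map_ofNat, map_one, RatFunc.algebraMap_X]
    ring
  · intro k hk
    simp only [numPoly, interlace_three_mul_add_one, Nat.one_le_iff_ne_zero.mp hk, if_false,
      map_neg, map_mul, map_pow, map_natCast, map_ofNat, RatFunc.algebraMap_X]
    ring
  · intro k
    simp only [numPoly, interlace_three_mul_add_two, map_neg, map_mul, map_add, map_pow,
      map_natCast, map_ofNat, map_one, RatFunc.algebraMap_X]
    ring
  · simp [denPoly, interlace]
  · intro k hk
    simp only [denPoly, interlace_three_mul, Nat.one_le_iff_ne_zero.mp hk, if_false, map_mul,
      map_sub, map_natCast, map_ofNat, map_one, RatFunc.algebraMap_X]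
    ring
  · intro k
    simp only [denPoly, interlace_three_mul_add_one, map_mul, map_add, map_sub, map_natCast,
      map_ofNat, map_one, RatFunc.algebraMap_X]
    ring
  · intro k
    simp only [denPoly, interlace_three_mul_add_two, map_mul, map_add, map_sub, map_pow,
      map_natCast, map_ofNat, map_one, RatFunc.algebraMap_X]
    ring
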